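/- All graphs are finite and have no loops; parallel edges are allowed, so that the statement covers in particular every finite simple graph. A graph is *matching covered* if it is connected, has at least one edge, and each of its edges lies in a perfect matching. Let $G$ be a graph with vertices enumerated as $1,\dots,2m$. For an orientation $D$ of $G$ and a perfect matching $M$ whose edges are oriented in $D$ from $u_i$ to $v_i$ ($1\le i\le m$), let $\operatorname{sign}_D(M)$ be the sign of the permutation $\begin{pmatrix}1&2&\cdots&2m-1&2m\\u_1&v_1&\cdots&u_m&v_m\end{pmatrix}$; it does not depend on the order in which the edges of $M$ are listed. For a positive integer $k$, the graph $G$ is *$k$-pfaffian* if it has orientations $D_1,\dots,D_k$ and there is $x\in\mathbb{R}^k$ with $\sum_{i=1}^k \operatorname{sign}_{D_i}(M)\,x_i=1$ for every perfect matching $M$ of $G$; this does not depend on the enumeration of the vertices. (A graph with an odd number of vertices has no perfect matching, and the condition is then empty.) The *pfaffian number* $\mathrm{pf}(G)$ is the smallest positive integer $k$ such that $G$ is $k$-pfaffian. For $X\subseteq V(G)$ let $\overline X=V(G)\setminus X$, let $\partial(X)$ be the set of edges with one end in $X$ and the other in $\overline X$, and let $G/X$ be the graph obtained from $G$ by contracting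 $X$ to a single vertex and removing the resulting loops (parallel edges are kept). For a matching covered graph $G$, the cut $\partial(X)$ is *separating* if both $G/X$ and $G/\overline X$ are matching covered. **Corollary.** Let $G$ be a matching covered graph and let $C=\partial(X)$ be a separating cut of $G$. Then $$\mathrm{pf}(G)\ \ge\ \max\{\mathrm{pf}(G/X),\ \mathrm{pf}(G/\overline X)\}.$$ -/

import Mathlib

open scoped Graph

namespace Graph

/-- `G` is connected: it has a vertex, and any two vertices are joined by a walk. -/
def IsConnected {α β : Type*} (G : Graph α β) : Prop :=
  V(G).Nonempty ∧ ∀ x ∈ V(G), ∀ y ∈ V(G), Relation.ReflTransGen G.Adj x y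

/-- `M` is a perfect matching of the (loopless) graph `G`: a set of edges such that every vertex
is incident with exactly one of them. -/
def IsPerfectMatching {α β : Type*} (G : Graph α β) (M : Set β) : Prop :=
  M ⊆ E(G) ∧ ∀ v ∈ V(G), ∃! e, e ∈ M ∧ G.Inc e v

/-- `G` is matching covered: connected, with at least one edge, and every edge lies in some
perfect matching. -/
def IsMatchingCovered {α β : Type*} (G : Graph α β) : Prop :=
  G.IsConnected ∧ E(G).Nonempty ∧ ∀ e ∈ E(G), ∃ M, G.IsPerfectMatching M ∧ e ∈ M

/-- An orientation of `G`: each edge (parallel edges independently) is oriented from one of its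
ends, its tail, to the other one, its head. -/
structure Orientation {α β : Type*} (G : Graph α β) where
  tail : E(G) → V(G)
  head : E(G) → V(G)
  isLink : ∀ e : E(G), G.IsLink (e : β) (tail e) (head e)

/-- For an enumeration `ν` of the `2m` vertices by the positions `0, …, 2m - 1`, the statement that
`π` is a permutation of `M` in `D` (for some order `e₀, …, e_{m-1}` of the edges of `M`), that is,
`π` maps `2i` to (the number of) the tail `uᵢ` of `eᵢ` and `2i + 1` to the head `vᵢ` of `eᵢ`.
Here `finProdFinEquiv (i, j) = j + 2 * i`. -/
def IsMatchingPerm {α β : Type*} {G : Graph α β} {m : ℕ} (ν : V(G) ≃ Fin (m * 2))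
    (D : G.Orientation) (M : Set β) (π : Equiv.Perm (Fin (m * 2))) : Prop :=
  ∀ i : Fin m, ∃ e : E(G), (e : β) ∈ M ∧
    π (finProdFinEquiv (i, 0)) = ν (D.tail e) ∧ π (finProdFinEquiv (i, 1)) = ν (D.head e)

open Classical in
/-- The sign of the perfect matching `M` in the orientation `D`, with respect to the enumeration
`ν` of the vertices: the sign of a permutation of `M` in `D`. It does not depend on the order in
which the edges of `M` are listed, see `matchingSign_eq`; such a permutation exists for every
perfect matching, see `exists_isMatchingPerm`. -/
noncomputable def matchingSign {α β : Type*} {G : Graph α β} {m : ℕ} (ν : V(G) ≃ Fin (m * 2))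
    (D : G.Orientation) (M : Set β) : ℤˣ :=
  if h : ∃ π, IsMatchingPerm ν D M π then Equiv.Perm.sign h.choose else 1

theorem IsPerfectMatching.unique {α β : Type*} {G : Graph α β} {M : Set β}
    (hM : G.IsPerfectMatching M) {v : α} {e f : β} (he : e ∈ M) (hf : f ∈ M)
    (hev : G.Inc e v) (hfv : G.Inc f v) : e = f :=
  (hM.2 v hev.vertex_mem).unique ⟨he, hev⟩ ⟨hf, hfv⟩

theorem exists_isMatchingPerm {α β : Type*} {G : Graph α β} (hl : G.Loopless) {m : ℕ}
    (ν : V(G) ≃ Fin (m * 2)) (D : G.Orientation) {M : Set β} (hM : G.IsPerfectMatching M) :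
    ∃ π, IsMatchingPerm ν D M π := by
  let ed : M → E(G) := fun e => ⟨e, hM.1 e.2⟩
  let φ : M × Fin 2 → V(G) := fun p => if p.2 = 0 then D.tail (ed p.1) else D.head (ed p.1)
  have hinc : ∀ p, G.Inc p.1 (φ p) := by
    rintro ⟨e, j⟩
    fin_cases j
    · exact (D.isLink (ed e)).inc_left
    · exact (D.isLink (ed e)).inc_right
  have hφ : Function.Bijective φ := by
    constructor
    · rintro ⟨e, j⟩ ⟨f, k⟩ h
      have h1 : e = f := Subtype.ext (hM.unique e.2 f.2 (hinc (e, j)) (by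
        rw [h]; exact hinc (f, k)))
      subst h1
      have hne : D.tail (ed e) ≠ D.head (ed e) := fun h' =>
        (D.isLink (ed e)).ne (congrArg Subtype.val h')
      fin_cases j <;> fin_cases k <;> simp_all [φ]
    · intro v
      obtain ⟨e, ⟨he, hev⟩, -⟩ := hM.2 v v.2
      rcases hev.eq_or_eq_of_isLink (D.isLink (ed ⟨e, he⟩)) with h | h
      · exact ⟨(⟨e, he⟩, 0), by simp only [φ]; exact Subtype.ext h.symm⟩
      · exact ⟨(⟨e, he⟩, 1), by simp only [φ]; exact Subtype.ext h.symm⟩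
  let Φ := Equiv.ofBijective φ hφ
  have hfin : Finite M := by
    have : Finite (M × Fin 2) := Finite.of_equiv _ (Φ.trans ν).symm
    exact Finite.of_injective (fun e : M => (e, (0 : Fin 2))) (fun a b h => (Prod.ext_iff.1 h).1)
  have hcard : Nat.card M = m := by
    have := Nat.card_congr (Φ.trans ν)
    simp at this
    simpa using this
  let l : Fin m ≃ M := (Finite.equivFinOfCardEq hcard).symm
  refine ⟨finProdFinEquiv.symm.trans ((Equiv.prodCongr l (Equiv.refl _)).trans (Φ.trans ν)), ?_⟩
  intro i
  exact ⟨ed (l i), (l i).2, by simp [Φ, φ], by simp [Φ, φ]⟩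

theorem IsMatchingPerm.sign_eq {α β : Type*} {G : Graph α β} {m : ℕ}
    {ν : V(G) ≃ Fin (m * 2)} {D : G.Orientation} {M : Set β} (hM : G.IsPerfectMatching M)
    {π π' : Equiv.Perm (Fin (m * 2))} (h : IsMatchingPerm ν D M π)
    (h' : IsMatchingPerm ν D M π') : Equiv.Perm.sign π = Equiv.Perm.sign π' := by
  have key : ∀ i : Fin m, ∃ j : Fin m, ∀ t : Fin 2,
      π (finProdFinEquiv (i, t)) = π' (finProdFinEquiv (j, t)) := by
    intro i
    obtain ⟨e, heM, h0, h1⟩ := h i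
    obtain ⟨⟨j, s⟩, hs⟩ := (finProdFinEquiv.trans π').surjective (ν (D.tail e))
    simp only [Equiv.trans_apply] at hs
    obtain ⟨f, hfM, g0, g1⟩ := h' j
    have hef : e = f := by
      refine Subtype.ext (hM.unique heM hfM (D.isLink e).inc_left ?_)
      fin_cases s
      · have : D.tail e = D.tail f := ν.injective (hs.symm.trans g0)
        rw [this]; exact (D.isLink f).inc_left
      · have : D.tail e = D.head f := ν.injective (hs.symm.trans g1)
        rw [this]; exact (D.isLink f).inc_right
    subst hef
    refine ⟨j, fun t => ?_⟩
    fin_cases t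
    · exact h0.trans g0.symm
    · exact h1.trans g1.symm
  choose τ hτ using key
  have hinj : Function.Injective τ := by
    intro i i' hi
    have h2 := (hτ i 0).trans ((congrArg (fun j => π' (finProdFinEquiv (j, 0))) hi).trans
      (hτ i' 0).symm)
    exact (Prod.ext_iff.1 (finProdFinEquiv.injective (π.injective h2))).1
  let T : Equiv.Perm (Fin m) := Equiv.ofBijective τ (Finite.injective_iff_bijective.1 hinj)
  let B : Equiv.Perm (Fin m × Fin 2) := Equiv.prodCongrLeft (fun _ : Fin 2 => T)
  have hπ : π = π' * finProdFinEquiv.permCongr B := by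
    ext1 p
    obtain ⟨⟨i, t⟩, rfl⟩ := finProdFinEquiv.surjective p
    simp only [Equiv.Perm.mul_apply, Equiv.permCongr_apply, Equiv.symm_apply_apply]
    exact hτ i t
  have hB : Equiv.Perm.sign B = 1 := by
    have : Equiv.Perm.sign B = ∏ _t : Fin 2, Equiv.Perm.sign T := Equiv.Perm.sign_prodCongrLeft _
    rw [this, Fin.prod_univ_two, Int.units_mul_self]
  rw [hπ, Equiv.Perm.sign_mul, Equiv.Perm.sign_permCongr, hB, mul_one]

theorem matchingSign_eq {α β : Type*} {G : Graph α β} {m : ℕ}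
    {ν : V(G) ≃ Fin (m * 2)} {D : G.Orientation} {M : Set β} (hM : G.IsPerfectMatching M)
    {π : Equiv.Perm (Fin (m * 2))} (h : IsMatchingPerm ν D M π) :
    matchingSign ν D M = Equiv.Perm.sign π := by
  have hex : ∃ π, IsMatchingPerm ν D M π := ⟨π, h⟩
  rw [matchingSign, dif_pos hex]
  exact IsMatchingPerm.sign_eq hM hex.choose_spec h

/-- The `k`-orientation `D = (D₁, …, D_k)` is pfaffian: the linear system over `ℝ` whose rows are
the sign vectors of the perfect matchings in `D`, with right-hand side the all-ones vector, is
solvable. The condition is imposed for every enumeration `ν` of the vertices; relabelling the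
vertices multiplies each `Dᵢ`-sign of all perfect matchings by one common factor `±1`, so it is the
same condition for all `ν`. A graph with an odd number of vertices has no perfect matchings, and
for it the system has no equations. -/
def IsPfaffianKOrientation {α β : Type*} {G : Graph α β} {k : ℕ} (D : Fin k → G.Orientation) :
    Prop :=
  ∀ (m : ℕ) (ν : V(G) ≃ Fin (m * 2)), ∃ x : Fin k → ℝ, ∀ M : Set β, G.IsPerfectMatching M →
    ∑ i, ((matchingSign ν (D i) M : ℤ) : ℝ) * x i = 1

/-- `G` is `k`-pfaffian: it admits a pfaffian `k`-orientation. -/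
def IsKPfaffian {α β : Type*} (G : Graph α β) (k : ℕ) : Prop :=
  ∃ D : Fin k → G.Orientation, IsPfaffianKOrientation D

/-- The pfaffian number of `G`: the smallest positive integer `k` such that `G` is `k`-pfaffian. -/
noncomputable def pfaffianNumber {α β : Type*} (G : Graph α β) : ℕ :=
  sInf {k : ℕ | 0 < k ∧ G.IsKPfaffian k}

open Classical in
/-- The map that identifies all vertices of `X` to one new vertex `none`. -/
noncomputable def contractMap {α : Type*} (X : Set α) (v : α) : Option α :=
  if v ∈ X then none else some v

/-- The contraction `G / X`: the vertices in `X` are identified to a single vertex and the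
resulting loops are removed. Parallel edges are kept. -/
noncomputable def contract {α β : Type*} (G : Graph α β) (X : Set α) : Graph (Option α) β :=
  (G.map (contractMap X)).deleteEdges {e | ∃ x, (G.map (contractMap X)).IsLoopAt e x}

/-- The cut `∂(X)` of `G` is separating: both of its contractions `G / X` and `G / (V(G) \ X)`
are matching covered. -/
def IsSeparatingCut {α β : Type*} (G : Graph α β) (X : Set α) : Prop :=
  (G.contract X).IsMatchingCovered ∧ (G.contract (V(G) \ X)).IsMatchingCovered

end Graph

namespace Graph

variable {α β : Type*} {G : Graph α β}

/-! A pfaffian `k`-orientation of `G` is carried over to `G / X` with the same coefficients `x`;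
write `Y` for the complement of `X`. For each cut edge `e` fix a perfect matching `M e` of `G / Y`
through `e`. A perfect matching `N'` of `G / X` has exactly one cut edge `e`, and `N' ∪ M e` is a
perfect matching of `G` (`IsPerfectMatching.union_of_contract`). For a fixed orientation of `G`, the
ratio of the sign of `N' ∪ M e` to that of `N'` in the inherited orientation depends only on `e`
(`matchingSign_union_mul`). Reversing exactly the cut edges with ratio `-1` makes the two signs
equal (`matchingSign_flip`), so the equation of `N'` becomes the equation of `N' ∪ M e`, which `x`
solves. Since `sInf ∅ = 0`, the comparison of pfaffian numbers also needs `G` to be `k`-pfaffian for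
some positive `k` (`exists_isKPfaffian`). -/

theorem units_cast_mul_self (u : ℤˣ) : ((u : ℤ) : ℝ) * ((u : ℤ) : ℝ) = 1 := by
  rcases Int.units_eq_one_or u with rfl | rfl <;> norm_num

/-! ### Signs of perfect matchings under relabelling and reversal -/

section Signs

theorem exists_matchingEquiv (hl : G.Loopless) (D : G.Orientation) {M : Set β}
    (hM : G.IsPerfectMatching M) :
    ∃ Φ : M × Fin 2 ≃ V(G), ∀ e : M,
      Φ (e, 0) = D.tail ⟨e, hM.1 e.2⟩ ∧ Φ (e, 1) = D.head ⟨e, hM.1 e.2⟩ := by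
  let ed : M → E(G) := fun e => ⟨e, hM.1 e.2⟩
  let φ : M × Fin 2 → V(G) := fun p => if p.2 = 0 then D.tail (ed p.1) else D.head (ed p.1)
  have hinc : ∀ p, G.Inc p.1 (φ p) := by
    rintro ⟨e, j⟩
    fin_cases j
    · exact (D.isLink (ed e)).inc_left
    · exact (D.isLink (ed e)).inc_right
  have hφ : Function.Bijective φ := by
    constructor
    · rintro ⟨e, j⟩ ⟨f, k⟩ h
      obtain rfl : e = f := Subtype.ext (hM.unique e.2 f.2 (hinc (e, j)) (by
        rw [h]; exact hinc (f, k)))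
      have hne : D.tail (ed e) ≠ D.head (ed e) := fun h' =>
        (D.isLink (ed e)).ne (congrArg Subtype.val h')
      fin_cases j <;> fin_cases k <;> simp_all [φ]
    · intro v
      obtain ⟨e, ⟨he, hev⟩, -⟩ := hM.2 v v.2
      rcases hev.eq_or_eq_of_isLink (D.isLink (ed ⟨e, he⟩)) with h | h
      · exact ⟨(⟨e, he⟩, 0), by simp only [φ]; exact Subtype.ext h.symm⟩
      · exact ⟨(⟨e, he⟩, 1), by simp only [φ]; exact Subtype.ext h.symm⟩
  exact ⟨Equiv.ofBijective φ hφ, fun e => ⟨by simp [φ, ed], by simp [φ, ed]⟩⟩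

instance nonempty_orientation : Nonempty G.Orientation := by
  have h : ∀ e : E(G), ∃ p : V(G) × V(G), G.IsLink e p.1 p.2 := fun e => by
    obtain ⟨x, y, hxy⟩ := exists_isLink_of_mem_edgeSet e.2
    exact ⟨(⟨x, hxy.left_mem⟩, ⟨y, hxy.right_mem⟩), hxy⟩
  choose p hp using h
  exact ⟨⟨fun e => (p e).1, fun e => (p e).2, hp⟩⟩

theorem IsPerfectMatching.exists_equiv_fin (hl : G.Loopless) (hV : V(G).Finite) {M : Set β}
    (hM : G.IsPerfectMatching M) : ∃ m, Nonempty (V(G) ≃ Fin (m * 2)) := by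
  obtain ⟨D⟩ := nonempty_orientation (G := G)
  obtain ⟨Φ, -⟩ := exists_matchingEquiv hl D hM
  have := hV.to_subtype
  have h := Nat.card_congr Φ
  simp only [Nat.card_prod, Nat.card_eq_fintype_card (α := Fin 2), Fintype.card_fin] at h
  exact ⟨_, ⟨Finite.equivFinOfCardEq h.symm⟩⟩

/-- Composing a permutation of `M` in `D` with `σ`, transported along `ν`, gives a permutation of
`M'` in `D'`. All later sign comparisons within one enumeration reduce to this. -/
theorem matchingSign_map (hl : G.Loopless) [Fintype V(G)] [DecidableEq V(G)] {m : ℕ}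
    (ν : V(G) ≃ Fin (m * 2)) {D D' : G.Orientation} {M M' : Set β} (hM : G.IsPerfectMatching M)
    (hM' : G.IsPerfectMatching M') (σ : Equiv.Perm V(G))
    (h : ∀ e : E(G), (e : β) ∈ M → ∃ f : E(G), (f : β) ∈ M' ∧
      D'.tail f = σ (D.tail e) ∧ D'.head f = σ (D.head e)) :
    matchingSign ν D' M' = Equiv.Perm.sign σ * matchingSign ν D M := by
  obtain ⟨π, hπ⟩ := exists_isMatchingPerm hl ν D hM
  have hπ' : IsMatchingPerm ν D' M' (ν.permCongr σ * π) := by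
    intro i
    obtain ⟨e, he, h0, h1⟩ := hπ i
    obtain ⟨f, hf, g0, g1⟩ := h e he
    exact ⟨f, hf, by simp [h0, g0], by simp [h1, g1]⟩
  rw [matchingSign_eq hM hπ, matchingSign_eq hM' hπ', Equiv.Perm.sign_mul,
    Equiv.Perm.sign_permCongr]

theorem matchingSign_enum (hl : G.Loopless) {m : ℕ} (ν ν' : V(G) ≃ Fin (m * 2))
    (D : G.Orientation) {M : Set β} (hM : G.IsPerfectMatching M) :
    matchingSign ν' D M = Equiv.Perm.sign (ν.symm.trans ν') * matchingSign ν D M := by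
  obtain ⟨π, hπ⟩ := exists_isMatchingPerm hl ν D hM
  have hπ' : IsMatchingPerm ν' D M (ν.symm.trans ν' * π) := by
    intro i
    obtain ⟨e, he, h0, h1⟩ := hπ i
    exact ⟨e, he, by simp [h0], by simp [h1]⟩
  rw [matchingSign_eq hM hπ, matchingSign_eq hM hπ', Equiv.Perm.sign_mul]

/-- One enumeration suffices: a change of enumeration multiplies all signs by a common factor, which
is absorbed into `x`. -/
theorem isPfaffianKOrientation_of_enum (hl : G.Loopless) {k m : ℕ} {D : Fin k → G.Orientation}
    (ν : V(G) ≃ Fin (m * 2)) {x : Fin k → ℝ} (hx : ∀ M : Set β, G.IsPerfectMatching M →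
      ∑ i, ((matchingSign ν (D i) M : ℤ) : ℝ) * x i = 1) :
    IsPfaffianKOrientation D := by
  intro m' ν'
  obtain rfl : m = m' := by
    have := Fin.equiv_iff_eq.1 ⟨ν.symm.trans ν'⟩
    lia
  refine ⟨fun i => ((Equiv.Perm.sign (ν.symm.trans ν') : ℤ) : ℝ) * x i, fun M hM => ?_⟩
  rw [← hx M hM]
  refine Finset.sum_congr rfl fun i _ => ?_
  have h := units_cast_mul_self (Equiv.Perm.sign (ν.symm.trans ν'))
  rw [matchingSign_enum hl ν ν' (D i) hM]
  push_cast
  linear_combination (((matchingSign ν (D i) M : ℤ) : ℝ) * x i) * h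

open Classical in
/-- Reverse the edges `e` of `D` with `s e = -1`. -/
noncomputable def Orientation.flip (D : G.Orientation) (s : E(G) → ℤˣ) : G.Orientation where
  tail e := if s e = 1 then D.tail e else D.head e
  head e := if s e = 1 then D.head e else D.tail e
  isLink e := by
    split_ifs
    · exact D.isLink e
    · exact (D.isLink e).symm

-- Reversing an edge of `M` transposes its two ends, so each reversed edge of `M` contributes a
-- factor `-1`; edges outside `M` do not matter.
open Classical in
theorem matchingSign_flip (hl : G.Loopless) [Finite V(G)] [Fintype E(G)] {m : ℕ}
    (ν : V(G) ≃ Fin (m * 2)) (D : G.Orientation) (s : E(G) → ℤˣ) {M : Set β}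
    (hM : G.IsPerfectMatching M) :
    matchingSign ν (D.flip s) M =
      (∏ e : E(G), if (e : β) ∈ M then s e else 1) * matchingSign ν D M := by
  have := Fintype.ofFinite V(G)
  obtain ⟨Φ, hΦ⟩ := exists_matchingEquiv hl D hM
  have : Fintype M := Fintype.ofInjective (fun e : M => (⟨e, hM.1 e.2⟩ : E(G)))
    fun a b h => Subtype.ext (congrArg (fun e : E(G) => (e : β)) h)
  let ρ : M → Equiv.Perm (Fin 2) := fun e =>
    if s ⟨e, hM.1 e.2⟩ = 1 then 1 else Equiv.swap 0 1
  have hρ : ∀ e, Equiv.Perm.sign (ρ e) = s ⟨e, hM.1 e.2⟩ := by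
    intro e
    rcases Int.units_eq_one_or (s ⟨e, hM.1 e.2⟩) with h | h <;> simp [ρ, h]
  rw [matchingSign_map hl ν hM hM (Φ.permCongr (Equiv.prodCongrRight ρ))]
  · congr 1
    rw [Equiv.Perm.sign_permCongr, Equiv.Perm.sign_prodCongrRight, ← Finset.prod_filter]
    simp only [hρ]
    refine Finset.prod_bij (fun e _ => ⟨e, hM.1 e.2⟩) ?_ ?_ ?_ ?_
    · simp
    · intro a _ b _ h
      exact Subtype.ext (congrArg (fun e : E(G) => (e : β)) h)
    · intro e he
      exact ⟨⟨e, by simpa using he⟩, by simp, rfl⟩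
    · simp
  · intro e he
    refine ⟨e, he, ?_⟩
    have h0 := (hΦ ⟨e, he⟩).1
    have h1 := (hΦ ⟨e, he⟩).2
    simp only [Subtype.coe_eta] at h0 h1
    have h (j : Fin 2) : Φ.permCongr (Equiv.prodCongrRight ρ) (Φ (⟨e, he⟩, j)) =
        Φ (⟨e, he⟩, ρ ⟨e, he⟩ j) := by simp
    have g0 := h 0
    have g1 := h 1
    rw [h0] at g0
    rw [h1] at g1
    rw [g0, g1]
    by_cases hs : s e = 1 <;> simp [Orientation.flip, ρ, hs, h0, h1]

/-- Every finite graph is `k`-pfaffian for some `k`: use all `2 ^ |E|` orientations. -/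
theorem exists_isKPfaffian (hl : G.Loopless) (hV : V(G).Finite) (hE : E(G).Finite) :
    ∃ k, 0 < k ∧ G.IsKPfaffian k := by
  classical
  have := hV.to_subtype
  have := hE.fintype
  obtain ⟨D⟩ := nonempty_orientation (G := G)
  let F : Fin (Fintype.card (E(G) → ℤˣ)) ≃ (E(G) → ℤˣ) := (Fintype.equivFin _).symm
  refine ⟨_, Fintype.card_pos, fun i => D.flip (F i), ?_⟩
  intro m ν
  -- These are characters of the group of sign vectors on `E(G)`; distinct edge sets give orthogonal
  -- characters.
  let χ : Set β → (E(G) → ℤˣ) → ℤˣ := fun M s => ∏ e : E(G), if (e : β) ∈ M then s e else 1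
  have orth : ∀ M N : Set β, M ⊆ E(G) → N ⊆ E(G) →
      ∑ s, ((χ M s : ℤ) : ℝ) * ((χ N s : ℤ) : ℝ)
        = if M = N then (2 : ℝ) ^ Fintype.card E(G) else 0 := by
    intro M N hM hN
    have h1 : ∀ s, ((χ M s : ℤ) : ℝ) * ((χ N s : ℤ) : ℝ) =
        ∏ e : E(G), (((if (e : β) ∈ M then s e else 1 : ℤˣ) : ℤ) : ℝ) *
          (((if (e : β) ∈ N then s e else 1 : ℤˣ) : ℤ) : ℝ) := by
      intro s
      rw [Finset.prod_mul_distrib]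
      simp [χ]
    simp_rw [h1]
    rw [← Fintype.piFinset_univ, ← Finset.prod_univ_sum (fun _ => Finset.univ)
      (fun (e : E(G)) (u : ℤˣ) => (((if (e : β) ∈ M then u else 1 : ℤˣ) : ℤ) : ℝ) *
          (((if (e : β) ∈ N then u else 1 : ℤˣ) : ℤ) : ℝ))]
    have h2 : ∀ e : E(G), ∑ u : ℤˣ, (((if (e : β) ∈ M then u else 1 : ℤˣ) : ℤ) : ℝ) *
          (((if (e : β) ∈ N then u else 1 : ℤˣ) : ℤ) : ℝ) =
        if ((e : β) ∈ M ↔ (e : β) ∈ N) then 2 else 0 := by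
      intro e
      have : (Finset.univ : Finset ℤˣ) = {1, -1} := rfl
      rw [this, Finset.sum_pair (by decide)]
      by_cases h : (e : β) ∈ M <;> by_cases h' : (e : β) ∈ N <;> simp [h, h'] <;> norm_num
    simp_rw [h2]
    split_ifs with h
    · subst h
      simp
    · obtain ⟨e, he⟩ : ∃ e, ¬ (e ∈ M ↔ e ∈ N) := by
        by_contra! hc
        exact h (Set.ext hc)
      have heE : e ∈ E(G) := by
        by_contra hc
        exact he ⟨fun h => (hc (hM h)).elim, fun h => (hc (hN h)).elim⟩
      exact Finset.prod_eq_zero (Finset.mem_univ ⟨e, heE⟩) (if_neg he)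
  have hPfin : {N : Set β | G.IsPerfectMatching N}.Finite :=
    hE.finite_subsets.subset fun N hN => hN.1
  let P := hPfin.toFinset
  let c : ℝ := 2 ^ Fintype.card E(G)
  have hc : c ≠ 0 := by positivity
  -- The row of `N` in the system is its sign in `D` times `χ N`. The rows are orthogonal with
  -- squared norm `c`, so `c⁻¹` times their sum has inner product `1` with each of them.
  refine ⟨fun i => c⁻¹ * ∑ N ∈ P, ((matchingSign ν D N : ℤ) : ℝ) * ((χ N (F i) : ℤ) : ℝ),
    fun M hM => ?_⟩
  have hflip : ∀ i, matchingSign ν (D.flip (F i)) M = χ M (F i) * matchingSign ν D M :=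
    fun i => matchingSign_flip hl ν D (F i) hM
  simp only [hflip]
  rw [F.sum_comp (fun s => (((χ M s * matchingSign ν D M : ℤˣ) : ℤ) : ℝ) *
    (c⁻¹ * ∑ N ∈ P, ((matchingSign ν D N : ℤ) : ℝ) * ((χ N s : ℤ) : ℝ)))]
  have hsq := units_cast_mul_self (matchingSign ν D M)
  calc
    _ = ∑ N ∈ P, c⁻¹ * ((matchingSign ν D M : ℤ) : ℝ) * ((matchingSign ν D N : ℤ) : ℝ) *
        ∑ s, ((χ M s : ℤ) : ℝ) * ((χ N s : ℤ) : ℝ) := by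
      simp only [Finset.mul_sum]
      rw [Finset.sum_comm]
      refine Finset.sum_congr rfl fun N _ => Finset.sum_congr rfl fun s _ => ?_
      push_cast
      ring
    _ = ∑ N ∈ P, if M = N then (1 : ℝ) else 0 := by
      refine Finset.sum_congr rfl fun N hN => ?_
      have hN : G.IsPerfectMatching N := by simpa [P] using hN
      rw [orth M N hM.1 hN.1]
      split_ifs with h
      · subst h
        change c⁻¹ * _ * _ * c = 1
        field_simp
        linear_combination hsq
      · simp
    _ = 1 := by
      rw [Finset.sum_ite_eq, if_pos (by simpa [P] using hM)]

end Signs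
-- Edges, matchings and vertex permutations of contractions
section Contract

variable {X Y : Set α} {e : β} {v : α}

theorem contractMap_of_mem (h : v ∈ X) : contractMap X v = none := if_pos h

theorem contractMap_of_notMem (h : v ∉ X) : contractMap X v = some v := if_neg h

theorem contractMap_eq_none : contractMap X v = none ↔ v ∈ X := by
  by_cases h : v ∈ X <;> simp [contractMap, h]

theorem contractMap_inj {w : α} (hv : v ∉ X) (h : contractMap X v = contractMap X w) : v = w := by
  rw [contractMap_of_notMem hv] at h
  by_cases hw : w ∈ X
  · simp [contractMap_of_mem hw] at h
  · simpa [contractMap_of_notMem hw] using h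

theorem contract_isLink {a b : Option α} : (G.contract X).IsLink e a b ↔
    a ≠ b ∧ ∃ x y, G.IsLink e x y ∧ contractMap X x = a ∧ contractMap X y = b := by
  simp only [contract, deleteEdges_isLink, Set.mem_ofPred_eq, not_exists]
  refine ⟨fun ⟨h, hn⟩ => ⟨?_, h⟩, fun ⟨hab, h⟩ => ⟨h, fun x hx => hab ?_⟩⟩
  · rintro rfl
    exact hn _ h
  · have h' : (G.map (contractMap X)).IsLink e a b := h
    exact (hx.eq_of_inc h'.inc_left).symm.trans (hx.eq_of_inc h'.inc_right)

theorem contract_loopless : (G.contract X).Loopless :=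
  ⟨fun _ _ h => (contract_isLink.1 h).1 rfl⟩

theorem contract_edgeSet_subset : E(G.contract X) ⊆ E(G) := by
  intro e he
  obtain ⟨a, b, h⟩ := exists_isLink_of_mem_edgeSet he
  obtain ⟨-, x, y, h, -⟩ := contract_isLink.1 h
  exact h.edge_mem

theorem contractMap_ne_of_mem_edgeSet {x y : α} (he : e ∈ E(G.contract X)) (h : G.IsLink e x y) :
    contractMap X x ≠ contractMap X y := by
  obtain ⟨a, b, h'⟩ := exists_isLink_of_mem_edgeSet he
  obtain ⟨hab, x', y', h'', rfl, rfl⟩ := contract_isLink.1 h'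
  obtain ⟨rfl, rfl⟩ | ⟨rfl, rfl⟩ := h.eq_and_eq_or_eq_and_eq h''
  · exact hab
  · exact hab.symm

theorem contract_inc_contractMap (hl : G.Loopless) (hv : v ∉ X) :
    (G.contract X).Inc e (contractMap X v) ↔ G.Inc e v := by
  constructor
  · rintro ⟨b, h⟩
    obtain ⟨-, x, y, h, hx, -⟩ := contract_isLink.1 h
    rw [contractMap_inj hv hx.symm]
    exact h.inc_left
  · rintro ⟨w, h⟩
    exact ⟨contractMap X w, contract_isLink.2
      ⟨fun h' => h.ne (contractMap_inj hv h'), v, w, h, rfl, rfl⟩⟩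

theorem contract_inc_none :
    (G.contract X).Inc e none ↔ ∃ x y, G.IsLink e x y ∧ x ∈ X ∧ y ∉ X := by
  constructor
  · rintro ⟨b, h⟩
    obtain ⟨hb, x, y, h', hx, rfl⟩ := contract_isLink.1 h
    exact ⟨x, y, h', contractMap_eq_none.1 hx, fun hy => hb (contractMap_eq_none.2 hy).symm⟩
  · rintro ⟨x, y, h, hx, hy⟩
    exact ⟨contractMap X y, contract_isLink.2
      ⟨fun h' => hy (contractMap_eq_none.1 h'.symm), x, y, h, contractMap_of_mem hx, rfl⟩⟩

theorem contract_inc_none_of_inc (he : e ∈ E(G.contract X)) (hv : v ∈ X) (h : G.Inc e v) :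
    (G.contract X).Inc e none := by
  obtain ⟨w, h⟩ := h
  refine contract_inc_none.2 ⟨v, w, h, hv, fun hw => contractMap_ne_of_mem_edgeSet he h ?_⟩
  rw [contractMap_of_mem hv, contractMap_of_mem hw]

/-- Both sides say that `e` lies in the cut. Only complementarity within `V(G)` is assumed, so `X`
and `Y` can exchange roles. -/
theorem contract_inc_none_comm (hXY : ∀ v ∈ V(G), v ∈ Y ↔ v ∉ X) :
    (G.contract X).Inc e none ↔ (G.contract Y).Inc e none := by
  simp only [contract_inc_none]
  constructor
  · rintro ⟨x, y, h, hx, hy⟩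
    exact ⟨y, x, h.symm, (hXY y h.right_mem).2 hy, fun hx' => (hXY x h.left_mem).1 hx' hx⟩
  · rintro ⟨x, y, h, hx, hy⟩
    refine ⟨y, x, h.symm, ?_, (hXY x h.left_mem).1 hx⟩
    by_contra hy'
    exact hy ((hXY y h.right_mem).2 hy')

/-- Two perfect matchings of the cut contractions that agree on the cut combine to one of `G`. -/
theorem IsPerfectMatching.union_of_contract (hl : G.Loopless)
    (hXY : ∀ v ∈ V(G), v ∈ Y ↔ v ∉ X) {N M : Set β} (hN : (G.contract X).IsPerfectMatching N)
    (hM : (G.contract Y).IsPerfectMatching M) (heN : e ∈ N) (heM : e ∈ M)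
    (he : (G.contract X).Inc e none) : G.IsPerfectMatching (N ∪ M) := by
  have he' := (contract_inc_none_comm hXY).1 he
  refine ⟨Set.union_subset (hN.1.trans contract_edgeSet_subset)
    (hM.1.trans contract_edgeSet_subset), fun v hv => ?_⟩
  by_cases hvX : v ∈ X
  · have hvY : v ∉ Y := fun h => (hXY v hv).1 h hvX
    obtain ⟨f, ⟨hf, hfv⟩, hu⟩ := hM.2 (contractMap Y v) ⟨v, hv, rfl⟩
    rw [contract_inc_contractMap hl hvY] at hfv
    refine ⟨f, ⟨Or.inr hf, hfv⟩, ?_⟩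
    rintro g ⟨hg | hg, hgv⟩
    -- An edge of `N` meeting `X` is incident with the contracted vertex, hence is `e`, which also
    -- lies in `M`.
    · obtain rfl := hN.unique hg heN (contract_inc_none_of_inc (hN.1 hg) hvX hgv) he
      exact hu g ⟨heM, (contract_inc_contractMap hl hvY).2 hgv⟩
    · exact hu g ⟨hg, (contract_inc_contractMap hl hvY).2 hgv⟩
  · have hvY : v ∈ Y := (hXY v hv).2 hvX
    obtain ⟨f, ⟨hf, hfv⟩, hu⟩ := hN.2 (contractMap X v) ⟨v, hv, rfl⟩
    rw [contract_inc_contractMap hl hvX] at hfv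
    refine ⟨f, ⟨Or.inl hf, hfv⟩, ?_⟩
    rintro g ⟨hg | hg, hgv⟩
    · exact hu g ⟨hg, (contract_inc_contractMap hl hvX).2 hgv⟩
    · obtain rfl := hM.unique hg heM (contract_inc_none_of_inc (hM.1 hg) hvY hgv) he'
      exact hu g ⟨heN, (contract_inc_contractMap hl hvX).2 hgv⟩

/-- The orientation of `G / X` inherited from `G`. -/
noncomputable def Orientation.contract (D : G.Orientation) (X : Set α) :
    (G.contract X).Orientation where
  tail e := ⟨contractMap X (D.tail ⟨e, contract_edgeSet_subset e.2⟩), _, Subtype.prop _, rfl⟩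
  head e := ⟨contractMap X (D.head ⟨e, contract_edgeSet_subset e.2⟩), _, Subtype.prop _, rfl⟩
  isLink e := 
    have h := D.isLink ⟨e, contract_edgeSet_subset e.2⟩
    contract_isLink.2 ⟨contractMap_ne_of_mem_edgeSet e.2 h, _, _, h, rfl, rfl⟩

/-- A permutation of the vertices of `G / X` that fixes the contracted vertex lifts to `G`. -/
theorem exists_perm_lift_contract [Fintype V(G)] [DecidableEq V(G)] [Fintype V(G.contract X)]
    [DecidableEq V(G.contract X)] (σ : Equiv.Perm V(G.contract X))
    (hσ : ∀ y : V(G.contract X), y.1 = none → σ y = y) :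
    ∃ τ : Equiv.Perm V(G), Equiv.Perm.sign τ = Equiv.Perm.sign σ ∧
      (∀ v : V(G), v.1 ∈ X → τ v = v) ∧
      ∀ v : V(G), v.1 ∉ X →
        contractMap X (τ v) = (σ ⟨contractMap X v, v.1, v.2, rfl⟩ : Option α) := by
  classical
  -- Away from the contracted vertex, `V(G / X)` is in bijection with the vertices of `G` outside
  -- `X`; restrict `σ` there and extend by the identity on `X`. Neither operation changes the sign.
  let p : V(G.contract X) → Prop := fun y => y.1 ≠ none
  have hp : ∀ y, p (σ y) ↔ p y := by
    intro y
    refine not_congr ⟨fun h => ?_, fun h => ?_⟩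
    · have := σ.injective (hσ _ h)
      rwa [this] at h
    · rwa [hσ y h]
  let q : V(G) → Prop := fun v => v.1 ∉ X
  let g : Subtype q → Subtype p := fun v =>
    ⟨⟨contractMap X v.1, v.1, v.1.2, rfl⟩, fun h => v.2 (contractMap_eq_none.1 h)⟩
  have hg : Function.Bijective g := by
    constructor
    · intro v w h
      have : contractMap X v.1 = contractMap X w.1 :=
        congrArg (fun y : Subtype p => (y.1.1 : Option α)) h
      exact Subtype.ext (Subtype.ext (contractMap_inj v.2 this))
    · rintro ⟨⟨y, v, hv, rfl⟩, hy⟩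
      exact ⟨⟨⟨v, hv⟩, fun h => hy (contractMap_of_mem h)⟩, rfl⟩
  let f : Subtype p ≃ Subtype q := (Equiv.ofBijective g hg).symm
  let τ := (σ.subtypePerm hp).extendDomain f
  refine ⟨τ, ?_, fun v hv => Equiv.Perm.extendDomain_apply_not_subtype _ _ (not_not.2 hv),
    fun v hv => ?_⟩
  · rw [Equiv.Perm.sign_extendDomain, Equiv.Perm.sign_subtypePerm]
    intro y hy h
    exact hy (hσ y h)
  · have h := Equiv.Perm.extendDomain_apply_subtype (σ.subtypePerm hp) f (b := v) hv
    have h2 : ∀ z : Subtype p, contractMap X (f z).1 = (z.1.1 : Option α) := by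
      intro z
      have := (Equiv.ofBijective g hg).apply_symm_apply z
      exact congrArg (fun y : Subtype p => (y.1.1 : Option α)) this
    rw [show τ v = _ from h, h2]
    rfl

end Contract
-- Transfer of pfaffian orientations to a contraction
variable {X Y : Set α}

/-- Two perfect matchings sharing the edge `e` differ by a vertex permutation that maps directed
edges to directed edges and fixes `e`. -/
theorem exists_perm_of_common_edge (hl : G.Loopless) (hV : V(G).Finite) (D : G.Orientation)
    {N₁ N₂ : Set β}
    (h₁ : G.IsPerfectMatching N₁) (h₂ : G.IsPerfectMatching N₂) {e : β} (he₁ : e ∈ N₁)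
    (he₂ : e ∈ N₂) :
    ∃ (σ : Equiv.Perm V(G)) (b : N₂ ≃ N₁), b ⟨e, he₂⟩ = ⟨e, he₁⟩ ∧ ∀ f : N₂,
      σ (D.tail ⟨f, h₂.1 f.2⟩) = D.tail ⟨b f, h₁.1 (b f).2⟩ ∧
      σ (D.head ⟨f, h₂.1 f.2⟩) = D.head ⟨b f, h₁.1 (b f).2⟩ := by
  classical
  obtain ⟨Φ₁, hΦ₁⟩ := exists_matchingEquiv hl D h₁
  obtain ⟨Φ₂, hΦ₂⟩ := exists_matchingEquiv hl D h₂
  have := hV.to_subtype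
  have : Finite (N₁ × Fin 2) := Finite.of_equiv _ Φ₁.symm
  have : Finite (N₂ × Fin 2) := Finite.of_equiv _ Φ₂.symm
  have : Finite N₁ := Finite.of_injective (fun f : N₁ => (f, (0 : Fin 2)))
    fun _ _ h => (Prod.ext_iff.1 h).1
  have : Finite N₂ := Finite.of_injective (fun f : N₂ => (f, (0 : Fin 2)))
    fun _ _ h => (Prod.ext_iff.1 h).1
  have hcard : Nat.card N₂ = Nat.card N₁ := by
    have := Nat.card_congr (Φ₂.trans Φ₁.symm)
    simpa using this
  obtain ⟨b₀⟩ : Nonempty (N₂ ≃ N₁) := Finite.card_eq.1 hcard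
  -- The swap corrects an arbitrary bijection so that it sends `e` to `e`.
  let b : N₂ ≃ N₁ := b₀.trans (Equiv.swap (b₀ ⟨e, he₂⟩) ⟨e, he₁⟩)
  refine ⟨(Φ₂.symm.trans (b.prodCongr (Equiv.refl _))).trans Φ₁, b, by simp [b], fun f => ?_⟩
  rw [← (hΦ₂ f).1, ← (hΦ₂ f).2, ← (hΦ₁ (b f)).1, ← (hΦ₁ (b f)).2]
  simp

/-- The permutation `σ` of `V(G / X)` carrying `N₂` to `N₁` fixes both ends of `e`, one of which is
the contracted vertex. It therefore lifts to a permutation `τ` of `V(G)` of the same sign that fixes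
`X` pointwise and carries `N₂ ∪ M` to `N₁ ∪ M`. Both signs change by the same factor. -/
theorem matchingSign_union_mul (hl : G.Loopless) (hV : V(G).Finite)
    (hXY : ∀ v ∈ V(G), v ∈ Y ↔ v ∉ X) {N₁ N₂ M : Set β} {e : β}
    (h₁ : (G.contract X).IsPerfectMatching N₁) (h₂ : (G.contract X).IsPerfectMatching N₂)
    (hM : (G.contract Y).IsPerfectMatching M) (he₁ : e ∈ N₁) (he₂ : e ∈ N₂) (heM : e ∈ M)
    (he : (G.contract X).Inc e none) (D : G.Orientation) {m m' : ℕ} (ν : V(G) ≃ Fin (m * 2))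
    (ν' : V(G.contract X) ≃ Fin (m' * 2)) :
    matchingSign ν D (N₁ ∪ M) * matchingSign ν' (D.contract X) N₁ =
      matchingSign ν D (N₂ ∪ M) * matchingSign ν' (D.contract X) N₂ := by
  classical
  have hlX : (G.contract X).Loopless := contract_loopless
  have hVX : V(G.contract X).Finite := hV.image _
  have := hV.fintype
  have := hVX.fintype
  obtain ⟨σ, b, hbe, hσ⟩ := exists_perm_of_common_edge hlX hVX (D.contract X) h₁ h₂ he₁ he₂
  -- the ends of `e` are fixed by `σ`
  have hfix : ∀ y : V(G.contract X), (G.contract X).Inc e y → σ y = y := by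
    intro y hy
    have h := hσ ⟨e, he₂⟩
    simp only [hbe] at h
    rcases hy.eq_or_eq_of_isLink ((D.contract X).isLink ⟨e, h₂.1 he₂⟩) with hy | hy
    · rw [Subtype.ext hy]
      exact h.1
    · rw [Subtype.ext hy]
      exact h.2
  have hnone : ∀ y : V(G.contract X), y.1 = none → σ y = y :=
    fun y hy => hfix y (hy ▸ he)
  obtain ⟨τ, hτσ, hτX, hτ⟩ := exists_perm_lift_contract σ hnone
  -- `τ` on the ends of a directed edge of `N₂` not in the cut
  have hcontr : ∀ f : N₂, f.1 ≠ e → ∀ v, G.Inc f v → v ∉ X := fun f hf v hv hvX =>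
    hf (h₂.unique f.2 he₂ (contract_inc_none_of_inc (h₂.1 f.2) hvX hv) he)
  have hcomp : ∀ v w : V(G), v.1 ∉ X →
      (σ ⟨contractMap X v, v.1, v.2, rfl⟩ : Option α) = contractMap X w → τ v = w := by
    intro v w hv h
    -- `τ v` cannot lie in `X`: it would be fixed by `τ`, forcing `v = τ v` by injectivity, while
    -- `v` is outside `X`.
    rw [← hτ v hv] at h
    refine Subtype.ext (contractMap_inj (fun hX => ?_) h)
    have h1 := hτX _ hX
    exact hv (τ.injective h1 ▸ hX)
  have heE : e ∈ E(G) := contract_edgeSet_subset (h₂.1 he₂)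
  have hτe : ∀ v : V(G), G.Inc e v → τ v = v := by
    intro v hv
    by_cases hvX : v.1 ∈ X
    · exact hτX v hvX
    · refine hcomp v v hvX ?_
      rw [hfix _ ((contract_inc_contractMap hl hvX).2 hv)]
  have hG : matchingSign ν D (N₁ ∪ M) = Equiv.Perm.sign τ * matchingSign ν D (N₂ ∪ M) := by
    refine matchingSign_map hl ν (h₂.union_of_contract hl hXY hM he₂ heM he)
      (h₁.union_of_contract hl hXY hM he₁ heM he) τ ?_
    intro f hf
    by_cases hfe : f.1 = e
    · exact ⟨f, Or.inr (hfe ▸ heM), (hτe _ (hfe ▸ (D.isLink f).inc_left)).symm,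
        (hτe _ (hfe ▸ (D.isLink f).inc_right)).symm⟩
    rcases hf with hf | hf
    · have hs := hσ ⟨f, hf⟩
      refine ⟨⟨b ⟨f, hf⟩, contract_edgeSet_subset (h₁.1 (b _).2)⟩, Or.inl (b _).2, ?_, ?_⟩
      · exact (hcomp _ _ (hcontr ⟨f, hf⟩ hfe _ (D.isLink f).inc_left)
          (congrArg Subtype.val hs.1)).symm
      · exact (hcomp _ _ (hcontr ⟨f, hf⟩ hfe _ (D.isLink f).inc_right)
          (congrArg Subtype.val hs.2)).symm
    · have hX : ∀ v : V(G), G.Inc f v → v.1 ∈ X := by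
        intro v hv
        by_contra hvX
        exact hfe (hM.unique hf heM (contract_inc_none_of_inc (hM.1 hf)
          ((hXY v v.2).2 hvX) hv) ((contract_inc_none_comm hXY).1 he))
      exact ⟨f, Or.inr hf, (hτX _ (hX _ (D.isLink f).inc_left)).symm,
        (hτX _ (hX _ (D.isLink f).inc_right)).symm⟩
  have hGX : matchingSign ν' (D.contract X) N₁ =
      Equiv.Perm.sign σ * matchingSign ν' (D.contract X) N₂ := by
    refine matchingSign_map hlX ν' h₂ h₁ σ fun f hf => ?_
    exact ⟨⟨b ⟨f, hf⟩, h₁.1 (b _).2⟩, (b _).2, (hσ ⟨f, hf⟩).1.symm, (hσ ⟨f, hf⟩).2.symm⟩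
  rw [hG, hGX, hτσ, mul_mul_mul_comm, Int.units_mul_self, one_mul]

theorem IsKPfaffian.contract (hl : G.Loopless) (hV : V(G).Finite) (hE : E(G).Finite)
    (hG : G.IsMatchingCovered) (hXY : ∀ v ∈ V(G), v ∈ Y ↔ v ∉ X)
    (hX : (G.contract X).IsMatchingCovered) (hY : (G.contract Y).IsMatchingCovered)
    {k : ℕ} (hk : G.IsKPfaffian k) (hne : ∃ v ∈ V(G), v ∈ X) : (G.contract X).IsKPfaffian k := by
  classical
  have hlX : (G.contract X).Loopless := contract_loopless
  have hVX : V(G.contract X).Finite := hV.image _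
  have := hVX.to_subtype
  have hEX : E(G.contract X).Finite := hE.subset contract_edgeSet_subset
  have := hEX.fintype
  obtain ⟨D, hD⟩ := hk
  obtain ⟨e, he⟩ := hG.2.1
  obtain ⟨M₀, hM₀, -⟩ := hG.2.2 e he
  obtain ⟨m, ⟨ν⟩⟩ := hM₀.exists_equiv_fin hl hV
  obtain ⟨e', he'⟩ := hX.2.1
  obtain ⟨N₀, hN₀, -⟩ := hX.2.2 e' he'
  obtain ⟨m', ⟨ν'⟩⟩ := hN₀.exists_equiv_fin hlX hVX
  obtain ⟨x, hx⟩ := hD m ν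
  -- `N e` is a reference matching of `G / X` against which the ratio at `e` is computed; off the
  -- cut the values are irrelevant.
  have hMN : ∀ e : β, ∃ M N : Set β, (G.contract X).Inc e none →
      (G.contract Y).IsPerfectMatching M ∧ e ∈ M ∧ (G.contract X).IsPerfectMatching N ∧ e ∈ N := by
    intro e
    by_cases he : (G.contract X).Inc e none
    · obtain ⟨M, hM, heM⟩ := hY.2.2 e ((contract_inc_none_comm hXY).1 he).edge_mem
      obtain ⟨N, hN, heN⟩ := hX.2.2 e he.edge_mem
      exact ⟨M, N, fun _ => ⟨hM, heM, hN, heN⟩⟩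
    · exact ⟨∅, ∅, fun h => (he h).elim⟩
  choose M N hMN using hMN
  let r : Fin k → E(G.contract X) → ℤˣ := fun i e =>
    if (G.contract X).Inc e none then
      matchingSign ν (D i) (N e ∪ M e) * matchingSign ν' ((D i).contract X) (N e) else 1
  refine ⟨fun i => ((D i).contract X).flip (r i),
    isPfaffianKOrientation_of_enum hlX ν' (x := x) fun N' hN' => ?_⟩
  have hv : none ∈ V(G.contract X) := by
    obtain ⟨v, hv, hvX⟩ := hne
    exact ⟨v, hv, contractMap_of_mem hvX⟩
  obtain ⟨e, ⟨heN', he⟩, -⟩ := hN'.2 none hv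
  obtain ⟨hM, heM, hN, heN⟩ := hMN e he
  rw [← hx _ (hN'.union_of_contract hl hXY hM heN' heM he)]
  refine Finset.sum_congr rfl fun i _ => ?_
  congr 3
  -- `r i` is `1` off the cut and `e` is the only cut edge of `N'`, so only the factor at `e`
  -- survives.
  rw [matchingSign_flip hlX ν' _ _ hN', Finset.prod_eq_single (⟨e, hN'.1 heN'⟩ : E(G.contract X))]
  · rw [if_pos heN']
    simp only [r]
    rw [if_pos he, ← matchingSign_union_mul hl hV hXY hN' hN hM heN' heN heM he (D i) ν ν',
      mul_assoc, Int.units_mul_self, mul_one]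
  · intro f _ hf
    split_ifs with hfN
    · refine if_neg fun hfi => hf (Subtype.ext ?_)
      exact hN'.unique hfN heN' hfi he
    · rfl
  · simp

theorem pfaffianNumber_contract_le (hl : G.Loopless) (hV : V(G).Finite) (hE : E(G).Finite)
    (hG : G.IsMatchingCovered) (hXY : ∀ v ∈ V(G), v ∈ Y ↔ v ∉ X)
    (hX : (G.contract X).IsMatchingCovered) (hY : (G.contract Y).IsMatchingCovered) :
    (G.contract X).pfaffianNumber ≤ G.pfaffianNumber := by
  obtain ⟨hpos, hk⟩ := Nat.sInf_mem (exists_isKPfaffian hl hV hE)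
  refine Nat.sInf_le ⟨hpos, hk.contract hl hV hE hG hXY hX hY ?_⟩
  -- otherwise `G / Y` has a single vertex, but it has an edge
  by_contra! hne
  obtain ⟨e, he⟩ := hY.2.1
  obtain ⟨a, b, h⟩ := exists_isLink_of_mem_edgeSet he
  obtain ⟨hab, x, y, hxy, rfl, rfl⟩ := contract_isLink.1 h
  refine hab ?_
  rw [contractMap_of_mem ((hXY x hxy.left_mem).2 (hne x hxy.left_mem)),
    contractMap_of_mem ((hXY y hxy.right_mem).2 (hne y hxy.right_mem))]

end Graph

theorem mainTheorem6 {α β : Type*} (G : Graph α β) (hV : V(G).Finite) (hE : E(G).Finite)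
    (hl : G.Loopless) (hG : G.IsMatchingCovered) (X : Set α) (hX : X ⊆ V(G))
    (hC : G.IsSeparatingCut X) :
    max (G.contract X).pfaffianNumber (G.contract (V(G) \ X)).pfaffianNumber
      ≤ G.pfaffianNumber := by
  refine max_le
    (Graph.pfaffianNumber_contract_le hl hV hE hG (fun v hv => ?_) hC.1 hC.2)
    (Graph.pfaffianNumber_contract_le hl hV hE hG (fun v hv => ?_) hC.2 hC.1)
  · simp [hv]
  · simp [hv]
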